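/- \textbf{Theorem.} If there is an algorithm that enumerates, with polynomial delay, all minimal connected dominating sets of a given split graph, then there is an algorithm that enumerates, with polynomial delay, all minimal hitting sets of a given hypergraph. Here graphs are finite, simple and undirected; $G=(V,E)$ is a \emph{split graph} if $V$ is the union of a clique and an independent set; $D\subseteq V$ is a \emph{connected dominating set} if every vertex of $V$ lies in $D$ or has a neighbour in $D$ and the induced subgraph $G[D]$ is connected (in particular $D\neq\emptyset$). A hypergraph is a pair $(X,\mathcal S)$ with $X$ finite and $\mathcal S\subseteq 2^X$; $H\subseteq X$ is a \emph{hitting set} if $H\cap S\ne\emptyset$ for all $S\in\mathcal S$. \emph{Minimal} means inclusion-minimal. Graphs are given with $V=\{0,\dots,n-1\}$ by $n$ and the adjacency matrix, hypergraphs with $X=\{0,\dots,n-1\}$ by $n$, $|\mathcal S|$ and the incidence matrix (with the edges listed in any order). An algorithm is a program for a random access machine with addition, truncated subtraction, multiplication and indirect addressing, under the logarithmic cost criterion. It \emph{enumerates} the solutions of an instance if it outputs each solution exactly once (as a list of its elements), outputs nothing else, and then halts. It does so \emph{with polynomial delay} if there is a polynomial $p$ such that on every instance the time before the first output, the time between any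 two consecutive outputs, and the time from the last output until halting (the whole running time, if there is no output) are at most $p(|V|)$ for a graph $G=(V,E)$, and at most $p(|X|+|\mathcal S|)$ for a hypergraph $(X,\mathcal S)$. -/

import Mathlib

namespace PolyDelay

/-! ### Random access machines with logarithmic cost

Programs are finite terms. They use number registers `x : ℕ` and arrays `a : ℕ` of numbers
(finitely many of each in every single program), and they write to a write-only output. -/

/-- Programs of a random access machine, written with structured control flow. -/
inductive Prog : Type
  /-- do nothing -/
  | skip : Prog
  /-- `x := k` -/
  | const (x k : ℕ) : Prog
  /-- `x := y + z` -/
  | add (x y z : ℕ) : Prog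
  /-- `x := y - z` (which is `0` if `y < z`) -/
  | sub (x y z : ℕ) : Prog
  /-- `x := y * z` -/
  | mul (x y z : ℕ) : Prog
  /-- `x := a[y]` (indirect addressing) -/
  | load (x a y : ℕ) : Prog
  /-- `a[y] := x` (indirect addressing) -/
  | store (a y x : ℕ) : Prog
  /-- write the content of `x` to the output -/
  | put (x : ℕ) : Prog
  /-- end the current output item -/
  | emit : Prog
  /-- first `c`, then `d` -/
  | seq (c d : Prog) : Prog
  /-- if `x ≠ 0` then `c` else `d` -/
  | ite (x : ℕ) (c d : Prog) : Prog
  /-- while `x ≠ 0` do `c` -/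
  | loop (x : ℕ) (c : Prog) : Prog

/-- The memory of the machine: contents of the registers and of the array cells. -/
structure State where
  reg : ℕ → ℕ
  mem : ℕ → ℕ → ℕ

/-- Assign `v` to the register `x`. -/
def State.setReg (s : State) (x v : ℕ) : State :=
  { s with reg := Function.update s.reg x v }

/-- Assign `v` to the cell `i` of the array `a`. -/
def State.setMem (s : State) (a i v : ℕ) : State :=
  { s with mem := Function.update s.mem a (Function.update (s.mem a) i v) }

/-- The initial memory on the input `f`: the input is in array `0`, and all else is zero. -/
def State.init (f : ℕ → ℕ) : State where
  reg := fun _ => 0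
  mem := fun a => if a = 0 then f else fun _ => 0

/-- What a computation does, seen from outside: it lets time pass, it writes a number to the
output, or it ends the current output item. -/
inductive Action : Type
  | tick (t : ℕ) : Action
  | put (v : ℕ) : Action
  | emit : Action

/-- The logarithmic cost of handling the number `v`: its binary length, plus one. -/
def logCost (v : ℕ) : ℕ := Nat.size v + 1

/-- `Exec c s tr s'`: started in memory `s`, the program `c` halts in memory `s'`, and `tr` is the
sequence of its actions in between. Every instruction costs the sum of the logarithmic
costs of the numbers (operands and addresses) that it handles. -/
inductive Exec : Prog → State → List Action → State → Prop
  | skip (s : State) : Exec .skip s [.tick 1] s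
  | const (s : State) (x k : ℕ) : Exec (.const x k) s [.tick (logCost k)] (s.setReg x k)
  | add (s : State) (x y z : ℕ) :
      Exec (.add x y z) s [.tick (logCost (s.reg y) + logCost (s.reg z))]
        (s.setReg x (s.reg y + s.reg z))
  | sub (s : State) (x y z : ℕ) :
      Exec (.sub x y z) s [.tick (logCost (s.reg y) + logCost (s.reg z))]
        (s.setReg x (s.reg y - s.reg z))
  | mul (s : State) (x y z : ℕ) :
      Exec (.mul x y z) s [.tick (logCost (s.reg y) + logCost (s.reg z))]
        (s.setReg x (s.reg y * s.reg z))
  | load (s : State) (x a y : ℕ) :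
      Exec (.load x a y) s [.tick (logCost (s.reg y) + logCost (s.mem a (s.reg y)))]
        (s.setReg x (s.mem a (s.reg y)))
  | store (s : State) (a y x : ℕ) :
      Exec (.store a y x) s [.tick (logCost (s.reg y) + logCost (s.reg x))]
        (s.setMem a (s.reg y) (s.reg x))
  | put (s : State) (x : ℕ) :
      Exec (.put x) s [.tick (logCost (s.reg x)), .put (s.reg x)] s
  | emit (s : State) : Exec .emit s [.tick 1, .emit] s
  | seq {c d : Prog} {s s' s'' : State} {tr tr' : List Action} :
      Exec c s tr s' → Exec d s' tr' s'' → Exec (.seq c d) s (tr ++ tr') s''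
  | ite_true {x : ℕ} {c d : Prog} {s s' : State} {tr : List Action} :
      s.reg x ≠ 0 → Exec c s tr s' →
        Exec (.ite x c d) s (.tick (logCost (s.reg x)) :: tr) s'
  | ite_false {x : ℕ} {c d : Prog} {s s' : State} {tr : List Action} :
      s.reg x = 0 → Exec d s tr s' →
        Exec (.ite x c d) s (.tick (logCost (s.reg x)) :: tr) s'
  | loop_true {x : ℕ} {c : Prog} {s s' s'' : State} {tr tr' : List Action} :
      s.reg x ≠ 0 → Exec c s tr s' → Exec (.loop x c) s' tr' s'' →
        Exec (.loop x c) s (.tick (logCost (s.reg x)) :: (tr ++ tr')) s''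
  | loop_false {x : ℕ} {c : Prog} {s : State} :
      s.reg x = 0 → Exec (.loop x c) s [.tick (logCost (s.reg x))] s

/-- The sequence of the output items of a run. An item is the list of the numbers written since
the previous item ended; `cur` is the part of the current item that has been written already. -/
def outputs : List ℕ → List Action → List (List ℕ)
  | _, [] => []
  | cur, .tick _ :: tr => outputs cur tr
  | cur, .put v :: tr => outputs (cur ++ [v]) tr
  | cur, .emit :: tr => cur :: outputs [] tr

/-- The delays of a run: the time until the first output item is complete, the times between
consecutive items, and the time from the last item until the machine halts (the whole running time
if there is no output); `t` is the time that has passed already since the last item. -/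
def delays : ℕ → List Action → List ℕ
  | t, [] => [t]
  | t, .tick k :: tr => delays (t + k) tr
  | t, .put _ :: tr => delays t tr
  | t, .emit :: tr => t :: delays 0 tr

/-! ### Enumeration problems and polynomial delay -/

/-- An enumeration problem whose solutions are finite sets of numbers. -/
structure EnumProblem where
  /-- the instances -/
  Inst : Type
  /-- the size of an instance -/
  size : Inst → ℕ
  /-- `IsCode i f`: the instance `i` may be given to a machine as the array `f` -/
  IsCode : Inst → (ℕ → ℕ) → Prop
  /-- the solutions of an instance -/
  sol : Inst → Set (Finset ℕ)

/-- There is an algorithm that enumerates, for every instance (however encoded), all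
solutions, each exactly once (as a list of its elements, in any order, repetitions of an element in
the list being harmless), outputs no other set, then halts, and whose
delays are all bounded by a polynomial in the size of the instance. -/
def EnumProblem.HasPolyDelayAlgorithm (P : EnumProblem) : Prop :=
  ∃ (c : Prog) (p : Polynomial ℕ), ∀ (i : P.Inst) (f : ℕ → ℕ), P.IsCode i f →
    ∃ (tr : List Action) (s' : State), Exec c (State.init f) tr s' ∧
      ((outputs [] tr).map List.toFinset).Nodup ∧
      (∀ D : Finset ℕ, D ∈ (outputs [] tr).map List.toFinset ↔ D ∈ P.sol i) ∧
      ∀ t ∈ delays 0 tr, t ≤ p.eval (P.size i)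

/-- A set of elements of `{0, …, n - 1}` as a set of numbers. -/
def toNats {n : ℕ} (D : Finset (Fin n)) : Finset ℕ := D.map Fin.valEmbedding

/-! ### Minimal connected dominating sets in split graphs -/

/-- The vertex set is the union of a clique `C` and an independent set. -/
def IsSplit {V : Type*} (G : SimpleGraph V) : Prop :=
  ∃ C : Set V, G.IsClique C ∧ G.IsIndepSet Cᶜ

/-- Every vertex is in `D` or has a neighbour in `D`. -/
def IsDominating {V : Type*} (G : SimpleGraph V) (D : Finset V) : Prop :=
  ∀ v, v ∈ D ∨ ∃ u ∈ D, G.Adj u v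

/-- Connected dominating sets: `D` is dominating and induces a connected subgraph. -/
def IsCDS {V : Type*} (G : SimpleGraph V) (D : Finset V) : Prop :=
  IsDominating G D ∧ (G.induce (D : Set V)).Connected

open Classical in
/-- The array `f` holds the number of vertices, followed by the adjacency matrix, row by row. -/
def IsGraphCode {n : ℕ} (G : SimpleGraph (Fin n)) (f : ℕ → ℕ) : Prop :=
  f 0 = n ∧
  (∀ u v : Fin n, f (1 + (u * n + v)) = if G.Adj u v then 1 else 0) ∧
  ∀ k, 1 + n * n ≤ k → f k = 0

/-- Enumerate all inclusion-minimal connected dominating sets of a split graph with vertices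
`0, …, n - 1`. The size of an instance is its number `n` of vertices. -/
def minimalCDSInSplitGraphs : EnumProblem where
  Inst := Σ n : ℕ, {G : SimpleGraph (Fin n) // IsSplit G}
  size := fun i => i.1
  IsCode := fun i f => IsGraphCode i.2.1 f
  sol := fun i => {D | ∃ D' : Finset (Fin i.1), Minimal (IsCDS i.2.1) D' ∧ D = toNats D'}

/-! ### Minimal hitting sets in hypergraphs -/

/-- `H` meets every edge of the hypergraph with the edge set `E`. -/
def IsHittingSet {X : Type*} [DecidableEq X] (E : Finset (Finset X)) (H : Finset X) : Prop :=
  ∀ S ∈ E, (H ∩ S).Nonempty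

/-- The array `f` holds the number of vertices and the number of edges, followed by the
incidence matrix, one row per edge, the edges being listed in an arbitrary order `e`. -/
def IsHypergraphCode {n : ℕ} (E : Finset (Finset (Fin n))) (f : ℕ → ℕ) : Prop :=
  ∃ e : Fin E.card ≃ {S // S ∈ E},
    f 0 = n ∧ f 1 = E.card ∧
    (∀ (j : Fin E.card) (x : Fin n), f (2 + (j * n + x)) = if x ∈ (e j).1 then 1 else 0) ∧
    ∀ k, 2 + E.card * n ≤ k → f k = 0

/-- Enumerate all inclusion-minimal hitting sets of a hypergraph with vertices `0, …, n - 1` and an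
arbitrary set of edges. The size of an instance is its number of vertices plus its number of
edges. -/
def minimalHittingSets : EnumProblem where
  Inst := Σ n : ℕ, Finset (Finset (Fin n))
  size := fun i => i.1 + i.2.card
  IsCode := fun i f => IsHypergraphCode i.2 f
  sol := fun i => {D | ∃ H : Finset (Fin i.1), Minimal (IsHittingSet i.2) H ∧ D = toNats H}

end PolyDelay

namespace PolyDelay

/-! ### Costs and silent runs -/

/-! Given a hypergraph on `X = {0, …, n - 1}` with `m` edges, make `X` and an apex `n` a clique, add
one independent vertex per edge, adjacent to the elements of that edge, and hang two pendant
vertices on the apex. The pendants force the apex into every connected dominating set, and the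
vertex of an edge forces an element of that edge. Conversely, the apex and a hitting set dominate
everything and induce a connected graph. So `D` is a connected dominating set iff it contains `n`
and `D ∩ X` is a hitting set (`isCDS_splitGraph_iff`), and `H ↦ H ∪ {n}` is a bijection between the
minimal solutions (`minimal_isCDS_splitGraph_iff`), inverted by deleting all numbers that are not
below `n`.

On the machine, a silent polynomial-time phase writes the adjacency matrix
(`exists_polynomial_splitGraphProg`). A copy of the given program then runs on fresh registers and
arrays and suppresses the numbers that are not below `n` (`exec_shiftFilter`). Its delays grow by a
factor linear in `n`, and the first one also by the time of the first phase. Since there is one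
output item per solution, no delay is lost by skipping or repeating items. -/

theorem logCost_le (v : ℕ) : logCost v ≤ v + 1 :=
  Nat.succ_le_succ (Nat.size_le.2 Nat.lt_two_pow_self)

theorem one_le_logCost (v : ℕ) : 1 ≤ logCost v := Nat.succ_le_succ (Nat.zero_le _)

/-- The trace `tr` produces no output and takes time `k`. -/
def Silent (tr : List Action) (k : ℕ) : Prop :=
  (∀ cur rest, outputs cur (tr ++ rest) = outputs cur rest) ∧
  ∀ t rest, delays t (tr ++ rest) = delays (t + k) rest

theorem silent_tick (k : ℕ) : Silent [.tick k] k := ⟨fun _ _ => rfl, fun _ _ => rfl⟩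

theorem Silent.append {tr tr' : List Action} {k k' : ℕ} (h : Silent tr k) (h' : Silent tr' k') :
    Silent (tr ++ tr') (k + k') :=
  ⟨fun cur rest => by rw [List.append_assoc, h.1, h'.1],
    fun t rest => by rw [List.append_assoc, h.2, h'.2, Nat.add_assoc]⟩

/-- From `s`, the program `c` halts in `s'` within time `T`, without any output. -/
def Runs (c : Prog) (s : State) (T : ℕ) (s' : State) : Prop :=
  ∃ tr k, Exec c s tr s' ∧ Silent tr k ∧ k ≤ T

theorem Runs.seq {c d : Prog} {s s' s'' : State} {T T' : ℕ} (h : Runs c s T s')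
    (h' : Runs d s' T' s'') : Runs (.seq c d) s (T + T') s'' := by
  obtain ⟨tr, k, h1, h2, h3⟩ := h
  obtain ⟨tr', k', h1', h2', h3'⟩ := h'
  exact ⟨_, _, .seq h1 h1', h2.append h2', Nat.add_le_add h3 h3'⟩

theorem Runs.loop {r : ℕ} {c : Prog} {S : ℕ → State} {L T C : ℕ}
    (hpos : ∀ k < L, (S k).reg r ≠ 0) (hend : (S L).reg r = 0)
    (hC : ∀ k ≤ L, logCost ((S k).reg r) ≤ C)
    (hstep : ∀ k < L, Runs c (S k) T (S (k + 1))) :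
    Runs (.loop r c) (S 0) (L * (T + C) + C) (S L) := by
  suffices h : ∀ j ≤ L, Runs (.loop r c) (S (L - j)) (j * (T + C) + C) (S L) by
    simpa using h L le_rfl
  -- Induction on the number `j` of remaining iterations, since a loop unfolds at its first
  -- iteration.
  intro j
  induction j with
  | zero => exact fun _ => ⟨_, _, .loop_false hend, silent_tick _, by simpa using hC L le_rfl⟩
  | succ j ih =>
    intro hj
    obtain ⟨tr', k', h1', h2', h3'⟩ := ih (by omega)
    have hlt : L - (j + 1) < L := by omega
    obtain ⟨tr, k, h1, h2, h3⟩ := hstep _ hlt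
    rw [show L - (j + 1) + 1 = L - j by omega] at h1
    refine ⟨_, _, .loop_true (hpos _ hlt) h1 h1', (silent_tick _).append (h2.append h2'), ?_⟩
    have := hC _ hlt.le
    rw [Nat.succ_mul]
    omega

/-! ### Programs without loops and outputs -/

/-- The program has no loops and writes no output. -/
def IsStraight : Prog → Prop
  | .put _ | .emit | .loop _ _ => False
  | .seq c d | .ite _ c d => IsStraight c ∧ IsStraight d
  | _ => True

/-- The memory after running a program without loops. -/
def ev : Prog → State → State
  | .const x k, s => s.setReg x k
  | .add x y z, s => s.setReg x (s.reg y + s.reg z)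
  | .sub x y z, s => s.setReg x (s.reg y - s.reg z)
  | .mul x y z, s => s.setReg x (s.reg y * s.reg z)
  | .load x a y, s => s.setReg x (s.mem a (s.reg y))
  | .store a y x, s => s.setMem a (s.reg y) (s.reg x)
  | .seq c d, s => ev d (ev c s)
  | .ite x c d, s => if s.reg x = 0 then ev d s else ev c s
  | _, s => s

/-- All numbers in the memory are at most `M`. -/
def Bounded (s : State) (M : ℕ) : Prop := (∀ x, s.reg x ≤ M) ∧ ∀ a i, s.mem a i ≤ M

theorem Bounded.mono {s : State} {M M' : ℕ} (h : Bounded s M) (hM : M ≤ M') : Bounded s M' :=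
  ⟨fun x => (h.1 x).trans hM, fun a i => (h.2 a i).trans hM⟩

theorem Bounded.setReg {s : State} {M : ℕ} (h : Bounded s M) (x : ℕ) {v : ℕ} (hv : v ≤ M) :
    Bounded (s.setReg x v) M := by
  refine ⟨fun y => ?_, h.2⟩
  by_cases hy : y = x
  · subst hy; simpa [State.setReg] using hv
  · simpa [State.setReg, hy] using h.1 y

theorem Bounded.setMem {s : State} {M : ℕ} (h : Bounded s M) (a i : ℕ) {v : ℕ} (hv : v ≤ M) :
    Bounded (s.setMem a i v) M := by
  refine ⟨h.1, fun b j => ?_⟩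
  by_cases hb : b = a
  · subst hb
    by_cases hj : j = i
    · subst hj; simpa [State.setMem] using hv
    · simpa [State.setMem, hj] using h.2 b j
  · simpa [State.setMem, hb] using h.2 b j

/-- Each instruction enlarges the numbers at most polynomially (multiplication squares the bound),
and the length of `c` is fixed, so finitely many polynomials are composed. One `q` bounds both the
time and the new numbers, which lets sequencing go through as `q'.comp q`. -/
theorem IsStraight.exists_polynomial {c : Prog} (hc : IsStraight c) :
    ∃ q : Polynomial ℕ, ∀ s M, Bounded s M →
      Runs c s (q.eval M) (ev c s) ∧ Bounded (ev c s) (q.eval M) := by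
  have atom : ∀ {c s s' M T}, Exec c s [.tick T] s' → T ≤ M → Runs c s M s' :=
    fun h hT => ⟨_, _, h, silent_tick _, hT⟩
  have lc : ∀ {v M : ℕ}, v ≤ M → logCost v ≤ M + 1 :=
    fun {v M} h => (logCost_le v).trans (by omega)
  induction c with
  | skip =>
    exact ⟨.X + 1, fun s M h => ⟨atom (.skip s) (by simp), h.mono (by simp)⟩⟩
  | const x k =>
    refine ⟨.X + .C k + 1, fun s M h => ⟨atom (.const s x k) ?_, ?_⟩⟩
    · have := logCost_le k; simp; omega
    · exact (h.mono (by simp; omega)).setReg _ (by simp; omega)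
  | add x y z =>
    refine ⟨2 * (.X + 1), fun s M h => ⟨atom (.add s x y z) ?_, ?_⟩⟩
    · have := lc (h.1 y); have := lc (h.1 z); simp; omega
    · have := h.1 y; have := h.1 z
      exact (h.mono (by simp; omega)).setReg _ (by simp; omega)
  | sub x y z =>
    refine ⟨2 * (.X + 1), fun s M h => ⟨atom (.sub s x y z) ?_, ?_⟩⟩
    · have := lc (h.1 y); have := lc (h.1 z); simp; omega
    · have := h.1 y
      exact (h.mono (by simp; omega)).setReg _ (by simp; omega)
  | mul x y z =>
    refine ⟨2 * (.X + 1) + .X * .X, fun s M h => ⟨atom (.mul s x y z) ?_, ?_⟩⟩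
    · have := lc (h.1 y); have := lc (h.1 z); simp; omega
    · have := Nat.mul_le_mul (h.1 y) (h.1 z)
      exact (h.mono (by simp; omega)).setReg _ (by simp; omega)
  | load x a y =>
    refine ⟨2 * (.X + 1), fun s M h => ⟨atom (.load s x a y) ?_, ?_⟩⟩
    · have := lc (h.1 y); have := lc (h.2 a (s.reg y)); simp; omega
    · have := h.2 a (s.reg y)
      exact (h.mono (by simp; omega)).setReg _ (by simp; omega)
  | store a y x =>
    refine ⟨2 * (.X + 1), fun s M h => ⟨atom (.store s a y x) ?_, ?_⟩⟩
    · have := lc (h.1 y); have := lc (h.1 x); simp; omega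
    · have := h.1 x
      exact (h.mono (by simp; omega)).setMem _ _ (by simp; omega)
  | put x => exact hc.elim
  | emit => exact hc.elim
  | loop x c => exact hc.elim
  | seq c d ihc ihd =>
    obtain ⟨q, hq⟩ := ihc hc.1
    obtain ⟨q', hq'⟩ := ihd hc.2
    refine ⟨q + q'.comp q, fun s M h => ?_⟩
    obtain ⟨h1, h2⟩ := hq s M h
    obtain ⟨h3, h4⟩ := hq' _ _ h2
    simp only [Polynomial.eval_add, Polynomial.eval_comp]
    exact ⟨h1.seq h3, h4.mono (by omega)⟩
  | ite x c d ihc ihd =>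
    obtain ⟨q, hq⟩ := ihc hc.1
    obtain ⟨q', hq'⟩ := ihd hc.2
    refine ⟨.X + 1 + q + q', fun s M h => ?_⟩
    have := lc (h.1 x)
    simp only [Polynomial.eval_add, Polynomial.eval_X, Polynomial.eval_one, ev]
    by_cases hx : s.reg x = 0
    · rw [if_pos hx]
      obtain ⟨⟨tr, k, h1, h2, h3⟩, h4⟩ := hq' s M h
      exact ⟨⟨_, _, .ite_false hx h1, (silent_tick _).append h2, by omega⟩,
        h4.mono (by omega)⟩
    · rw [if_neg hx]
      obtain ⟨⟨tr, k, h1, h2, h3⟩, h4⟩ := hq s M h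
      exact ⟨⟨_, _, .ite_true hx h1, (silent_tick _).append h2, by omega⟩,
        h4.mono (by omega)⟩

/-! ### The filtered, shifted copy of a program -/

/-- The program `c` with its registers shifted by `12` and its arrays by `1`, writing only those
numbers that are less than the content of register `0`. -/
def shiftFilter : Prog → Prog
  | .skip => .skip
  | .const x k => .const (x + 12) k
  | .add x y z => .add (x + 12) (y + 12) (z + 12)
  | .sub x y z => .sub (x + 12) (y + 12) (z + 12)
  | .mul x y z => .mul (x + 12) (y + 12) (z + 12)
  | .load x a y => .load (x + 12) (a + 1) (y + 12)
  | .store a y x => .store (a + 1) (y + 12) (x + 12)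
  | .put x => .seq (.sub 1 0 (x + 12)) (.ite 1 (.put (x + 12)) .skip)
  | .emit => .emit
  | .seq c d => .seq (shiftFilter c) (shiftFilter d)
  | .ite x c d => .ite (x + 12) (shiftFilter c) (shiftFilter d)
  | .loop x c => .loop (x + 12) (shiftFilter c)

/-- The memory `s'` holds a shifted copy of the memory `s`, and `n` in register `0`. -/
structure ShiftRel (n : ℕ) (s s' : State) : Prop where
  reg : ∀ x, s'.reg (x + 12) = s.reg x
  mem : ∀ a, s'.mem (a + 1) = s.mem a
  reg_zero : s'.reg 0 = n

theorem ShiftRel.setReg {n : ℕ} {s s' : State} (h : ShiftRel n s s') (x v : ℕ) :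
    ShiftRel n (s.setReg x v) (s'.setReg (x + 12) v) := by
  refine ⟨fun y => ?_, h.mem, ?_⟩
  · by_cases hy : y = x
    · subst hy; simp [State.setReg]
    · simpa [State.setReg, hy] using h.reg y
  · simpa [State.setReg, Function.update_apply] using h.reg_zero

theorem ShiftRel.setMem {n : ℕ} {s s' : State} (h : ShiftRel n s s') (a i v : ℕ) :
    ShiftRel n (s.setMem a i v) (s'.setMem (a + 1) i v) := by
  refine ⟨h.reg, fun b => ?_, h.reg_zero⟩
  by_cases hb : b = a
  · subst hb; simp [State.setMem, h.mem]
  · simpa [State.setMem, hb] using h.mem b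

/-- Register `1` lies outside the copy, so the output filter may use it as scratch. -/
theorem ShiftRel.setReg_one {n : ℕ} {s s' : State} (h : ShiftRel n s s') (v : ℕ) :
    ShiftRel n s (s'.setReg 1 v) :=
  ⟨fun y => by simpa [State.setReg, Function.update_apply] using h.reg y, h.mem,
    by simpa [State.setReg, Function.update_apply] using h.reg_zero⟩

theorem exists_mem_of_forall₂ {α β : Type*} {R : α → β → Prop} {l : List α} {l' : List β}
    (h : List.Forall₂ R l l') {b : β} (hb : b ∈ l') : ∃ a ∈ l, R a b := by
  induction h with
  | nil => simp at hb
  | cons hR _ ih =>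
    rcases List.mem_cons.1 hb with rfl | hb
    · exact ⟨_, List.mem_cons_self, hR⟩
    · obtain ⟨a, ha, h⟩ := ih hb
      exact ⟨a, List.mem_cons_of_mem _ ha, h⟩

/-- The second trace has the same output items as the first one, with only the numbers below `n`
retained, and its delays are bounded in terms of those of the first one. -/
def TraceBound (n A B : ℕ) (r r' : List Action) : Prop :=
  (∀ cur, outputs (cur.filter (· < n)) r' = (outputs cur r).map (List.filter (· < n))) ∧
  ∀ t t', t' ≤ A + B * t → List.Forall₂ (fun a b => b ≤ A + B * a) (delays t r) (delays t' r')

/-- Prepending the two traces preserves `TraceBound`. -/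
def TraceRel (n A B : ℕ) (tr tr' : List Action) : Prop :=
  ∀ r r', TraceBound n A B r r' → TraceBound n A B (tr ++ r) (tr' ++ r')

/-- Because `TraceRel` quantifies over the continuations, concatenation of traces is just
composition. -/
theorem TraceRel.append {n A B : ℕ} {tr tr' u u' : List Action} (h : TraceRel n A B tr tr')
    (h' : TraceRel n A B u u') : TraceRel n A B (tr ++ u) (tr' ++ u') := fun r r' hr => by
  rw [List.append_assoc, List.append_assoc]
  exact h _ _ (h' _ _ hr)

theorem traceBound_nil (n A B : ℕ) : TraceBound n A B [] [] :=
  ⟨fun _ => rfl, fun _ _ h => .cons h .nil⟩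

theorem traceRel_tick {n A B : ℕ} (hB : 1 ≤ B) (k : ℕ) :
    TraceRel n A B [.tick k] [.tick k] := fun _ _ hr => by
  refine ⟨hr.1, fun t t' ht => hr.2 _ _ ?_⟩
  have := Nat.mul_le_mul_right k hB
  rw [Nat.mul_add]
  omega

/-- Only `put` costs more in the copy: with `l ≥ 1` the cost of the original instruction, the
comparison with `n` and the branch bring it to at most `2 * n + 3 + 2 * l ≤ (2 * n + 5) * l`. The
summand `A` leaves room for time spent before the copy starts. -/
theorem exec_shiftFilter {n A B : ℕ} (hB : 2 * n + 5 ≤ B) {c : Prog} {s s₁ : State}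
    {tr : List Action} (h : Exec c s tr s₁) : ∀ {s'}, ShiftRel n s s' →
      ∃ tr' s₁', Exec (shiftFilter c) s' tr' s₁' ∧ ShiftRel n s₁ s₁' ∧ TraceRel n A B tr tr' := by
  have tk : ∀ k, TraceRel n A B [.tick k] [.tick k] := traceRel_tick (by omega)
  induction h with
  | skip s => exact fun hs => ⟨_, _, .skip _, hs, tk _⟩
  | const s x k => exact fun hs => ⟨_, _, .const _ _ _, hs.setReg _ _, tk _⟩
  | add s x y z =>
    intro s' hs
    have e := Exec.add s' (x + 12) (y + 12) (z + 12)
    rw [hs.reg, hs.reg] at e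
    exact ⟨_, _, e, hs.setReg _ _, tk _⟩
  | sub s x y z =>
    intro s' hs
    have e := Exec.sub s' (x + 12) (y + 12) (z + 12)
    rw [hs.reg, hs.reg] at e
    exact ⟨_, _, e, hs.setReg _ _, tk _⟩
  | mul s x y z =>
    intro s' hs
    have e := Exec.mul s' (x + 12) (y + 12) (z + 12)
    rw [hs.reg, hs.reg] at e
    exact ⟨_, _, e, hs.setReg _ _, tk _⟩
  | load s x a y =>
    intro s' hs
    have e := Exec.load s' (x + 12) (a + 1) (y + 12)
    rw [hs.reg, hs.mem] at e
    exact ⟨_, _, e, hs.setReg _ _, tk _⟩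
  | store s a y x =>
    intro s' hs
    have e := Exec.store s' (a + 1) (y + 12) (x + 12)
    rw [hs.reg, hs.reg] at e
    exact ⟨_, _, e, hs.setMem _ _ _, tk _⟩
  | put s x =>
    intro s' hs
    have e := Exec.sub s' 1 0 (x + 12)
    rw [hs.reg, hs.reg_zero] at e
    have hs1 := hs.setReg_one (n - s.reg x)
    set s₂ := s'.setReg 1 (n - s.reg x) with hs₂
    have h1 : s₂.reg 1 = n - s.reg x := by simp [hs₂, State.setReg]
    have l1 := one_le_logCost (s.reg x)
    have l2 := logCost_le n
    have l3 := (logCost_le (n - s.reg x)).trans (Nat.succ_le_succ (Nat.sub_le _ _))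
    have l4 : (2 * n + 5) * logCost (s.reg x) ≤ B * logCost (s.reg x) :=
      Nat.mul_le_mul_right _ hB
    have l5 : (2 * n + 3) * 1 ≤ (2 * n + 3) * logCost (s.reg x) := Nat.mul_le_mul_left _ l1
    by_cases hx : s.reg x < n
    · have e2 := Exec.put s₂ (x + 12)
      rw [hs1.reg] at e2
      refine ⟨_, _, .seq e (.ite_true (by omega) e2), hs1, fun r r' hr => ⟨fun cur => ?_, ?_⟩⟩
      · simpa [outputs, List.filter_append, hx] using hr.1 (cur ++ [s.reg x])
      · intro t t' ht
        rw [h1]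
        refine hr.2 _ _ ?_
        rw [Nat.mul_add]
        linarith
    · refine ⟨_, _, .seq e (.ite_false (by omega) (.skip _)), hs1,
        fun r r' hr => ⟨fun cur => ?_, ?_⟩⟩
      · simpa [outputs, List.filter_append, hx] using hr.1 (cur ++ [s.reg x])
      · intro t t' ht
        rw [h1]
        refine hr.2 _ _ ?_
        rw [Nat.mul_add]
        linarith
  | emit s =>
    intro s' hs
    refine ⟨_, _, .emit _, hs, fun r r' hr => ⟨fun cur => ?_, fun t t' ht => ?_⟩⟩
    · simpa [outputs] using hr.1 []
    · refine .cons ?_ (hr.2 _ _ (by omega))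
      rw [Nat.mul_add]
      omega
  | seq _ _ ih ih' =>
    intro s' hs
    obtain ⟨_, _, e, h1, h2⟩ := ih hs
    obtain ⟨_, _, e', h1', h2'⟩ := ih' h1
    exact ⟨_, _, .seq e e', h1', h2.append h2'⟩
  | @ite_true x _ _ _ _ _ hx _ ih =>
    intro s' hs
    obtain ⟨_, _, e, h1, h2⟩ := ih hs
    refine ⟨_, _, .ite_true (by rwa [hs.reg]) e, h1, ?_⟩
    rw [hs.reg]
    exact (tk _).append h2
  | @ite_false x _ _ _ _ _ hx _ ih =>
    intro s' hs
    obtain ⟨_, _, e, h1, h2⟩ := ih hs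
    refine ⟨_, _, .ite_false (by rwa [hs.reg]) e, h1, ?_⟩
    rw [hs.reg]
    exact (tk _).append h2
  | @loop_true x _ _ _ _ _ _ hx _ _ ih ih' =>
    intro s' hs
    obtain ⟨_, _, e, h1, h2⟩ := ih hs
    obtain ⟨_, _, e', h1', h2'⟩ := ih' h1
    refine ⟨_, _, .loop_true (by rwa [hs.reg]) e e', h1', ?_⟩
    rw [hs.reg]
    exact (tk _).append (h2.append h2')
  | @loop_false x _ _ hx =>
    intro s' hs
    refine ⟨_, _, .loop_false (by rwa [hs.reg]), hs, ?_⟩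
    rw [hs.reg]
    exact tk _

/-! ### The split graph of a hypergraph

The vertices `0, …, n` form a clique, the vertices `n + 1, …, n + m` are the edges of the
hypergraph, and the vertices `n + m + 1` and `n + m + 2` are pendant at `n`. -/

/-- The entry of the adjacency matrix in row `u` and column `v`, for `v < u`. -/
def lowerEntry (n m : ℕ) (f : ℕ → ℕ) (u v : ℕ) : ℕ :=
  if u ≤ n then 1
  else if v < n then f (2 + ((u - (n + 1)) * n + v))
  else if n < v then 0
  else if n + m < u then 1 else 0

/-- The entry of the adjacency matrix in row `u` and column `v`. -/
def entry (n m : ℕ) (f : ℕ → ℕ) (u v : ℕ) : ℕ :=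
  if v < u then lowerEntry n m f u v else if u < v then lowerEntry n m f v u else 0

theorem entry_comm (n m : ℕ) (f : ℕ → ℕ) (u v : ℕ) : entry n m f u v = entry n m f v u := by
  unfold entry
  split_ifs <;> first | rfl | omega

theorem entry_self (n m : ℕ) (f : ℕ → ℕ) (u : ℕ) : entry n m f u u = 0 := by simp [entry]

/-- The split graph of the hypergraph with incidence matrix `f`. -/
def splitGraph (n m : ℕ) (f : ℕ → ℕ) : SimpleGraph (Fin (n + m + 3)) where
  Adj u v := entry n m f u v = 1
  symm := ⟨fun u v h => by rwa [entry_comm]⟩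
  loopless := ⟨fun u h => by simp [entry_self] at h⟩

theorem entry_of_le {n m : ℕ} {f : ℕ → ℕ} {u v : ℕ} (hu : u ≤ n) (hv : v ≤ n) (h : u ≠ v) :
    entry n m f u v = 1 := by
  unfold entry lowerEntry
  split_ifs <;> first | rfl | omega

theorem entry_edge_left {n m : ℕ} {f : ℕ → ℕ} {j v : ℕ} (hj : j < m) :
    entry n m f (n + 1 + j) v = if v < n then f (2 + (j * n + v)) else 0 := by
  unfold entry lowerEntry
  rw [show n + 1 + j - (n + 1) = j by omega]
  split_ifs <;> first | rfl | omega

/-- For `i ≥ m` the lookup runs past the incidence matrix into the zero padding, so a pendant has no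
neighbour in `X` without a separate case in `lowerEntry`. -/
theorem entry_pendant {n m : ℕ} {f : ℕ → ℕ} {v : ℕ} (hf : ∀ k, 2 + m * n ≤ k → f k = 0) {i : ℕ}
    (hi : m ≤ i) : entry n m f (n + 1 + i) v = if v = n then 1 else 0 := by
  unfold entry lowerEntry
  rw [show n + 1 + i - (n + 1) = i by omega,
    hf _ (by have := Nat.mul_le_mul_right n hi; omega)]
  split_ifs <;> first | rfl | omega

theorem entry_eq_zero_of_lt {n m : ℕ} {f : ℕ → ℕ} {u v : ℕ} (hu : n < u) (hv : n < v) :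
    entry n m f u v = 0 := by
  unfold entry lowerEntry
  split_ifs <;> first | rfl | omega

theorem isSplit_splitGraph (n m : ℕ) (f : ℕ → ℕ) : IsSplit (splitGraph n m f) := by
  refine ⟨{v | v.1 ≤ n}, fun u hu v hv h => ?_, fun u hu v hv _ h => ?_⟩
  · exact entry_of_le hu hv fun h' => h (Fin.ext h')
  · simp only [Set.mem_compl_iff, Set.mem_ofPred_eq, not_le] at hu hv
    change entry n m f u v = 1 at h
    simp [entry_eq_zero_of_lt hu hv] at h

/-! ### Connected dominating sets of the split graph -/

theorem exists_adj_of_connected_induce {V : Type*} {G : SimpleGraph V} {D : Set V}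
    (h : (G.induce D).Connected) {u w : V} (hu : u ∈ D) (hw : w ∈ D) (huw : u ≠ w) :
    ∃ v ∈ D, G.Adj u v := by
  obtain ⟨p⟩ := h.preconnected ⟨u, hu⟩ ⟨w, hw⟩
  cases p with
  | nil => exact absurd rfl huw
  | @cons _ v _ h _ => exact ⟨v.1, v.2, h⟩

theorem isCDS_splitGraph_iff {n m : ℕ} {f : ℕ → ℕ} (hf : ∀ k, 2 + m * n ≤ k → f k = 0)
    (D : Finset (Fin (n + m + 3))) :
    IsCDS (splitGraph n m f) D ↔ (∃ z ∈ D, z.1 = n) ∧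
      ∀ j < m, ∃ x ∈ D, x.1 < n ∧ f (2 + (j * n + x)) = 1 := by
  constructor
  · rintro ⟨hdom, hcon⟩
    -- Unless `D ⊆ {u}`, the vertex `u` has a neighbour in `D`: by domination if `u ∉ D`, by
    -- connectedness if `u ∈ D`.
    have key : ∀ u : Fin (n + m + 3), (∃ w ∈ D, u ≠ w) → ∃ v ∈ D, entry n m f u v = 1 := by
      rintro u ⟨w, hw, huw⟩
      rcases hdom u with hu | ⟨v, hv, h⟩
      · exact exists_adj_of_connected_induce hcon hu hw huw
      · exact ⟨v, hv, by rw [entry_comm]; exact h⟩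
    have hz : ∃ z ∈ D, z.1 = n := by
      -- Two pendants are used because a single one could itself be all of `D`, as for `n = m = 0`;
      -- any member of `D` differs from one of the two.
      have pend : ∀ i : Fin 2, (∃ w ∈ D, n + 1 + (m + i.1) ≠ w.1) → ∃ z ∈ D, z.1 = n := by
        rintro i ⟨w, hw, h⟩
        obtain ⟨v, hv, h⟩ := key ⟨n + 1 + (m + i.1), by omega⟩
          ⟨w, hw, fun h' => h (congrArg Fin.val h')⟩
        rw [entry_pendant hf (by omega)] at h
        exact ⟨v, hv, by by_contra h'; simp [h'] at h⟩
      obtain ⟨⟨w, hw⟩⟩ := hcon.nonempty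
      by_cases h : n + 1 + (m + 0) = w.1
      · exact pend 1 ⟨w, hw, by simp; omega⟩
      · exact pend 0 ⟨w, hw, h⟩
    refine ⟨hz, fun j hj => ?_⟩
    obtain ⟨z, hzD, hz⟩ := hz
    obtain ⟨v, hv, h⟩ := key ⟨n + 1 + j, by omega⟩
      ⟨z, hzD, fun h => by have := congrArg Fin.val h; simp at this; omega⟩
    rw [entry_edge_left hj] at h
    by_cases hvn : v.1 < n
    · exact ⟨v, hv, hvn, by simpa [hvn] using h⟩
    · simp [hvn] at h
  · rintro ⟨⟨z, hzD, hz⟩, hhit⟩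
    -- A path of length at most two from `v` to the apex, with any inner vertex in `D`, yields both
    -- domination and connectedness.
    have step : ∀ v : Fin (n + m + 3), v ≠ z → (splitGraph n m f).Adj v z ∨
        ∃ x ∈ D, (splitGraph n m f).Adj v x ∧ (splitGraph n m f).Adj x z := by
      intro v hvz
      have hvn : v.1 ≠ n := fun h => hvz (Fin.ext (h.trans hz.symm))
      change entry n m f v z = 1 ∨ ∃ x ∈ D, entry n m f v x = 1 ∧ entry n m f x z = 1
      by_cases h1 : v.1 < n
      · exact .inl (entry_of_le h1.le hz.le (by omega))
      obtain ⟨j, hj⟩ : ∃ j, v.1 = n + 1 + j := ⟨v.1 - (n + 1), by omega⟩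
      by_cases h2 : j < m
      · obtain ⟨x, hx, hxn, hfx⟩ := hhit j h2
        refine .inr ⟨x, hx, ?_, entry_of_le hxn.le hz.le (by omega)⟩
        rw [hj, entry_edge_left h2, if_pos hxn, hfx]
      · left
        rw [hj, entry_pendant hf (by omega), if_pos hz]
    refine ⟨fun v => ?_, ?_⟩
    · by_cases hvz : v = z
      · exact .inl (hvz ▸ hzD)
      · rcases step v hvz with h | ⟨x, hx, h, -⟩
        · exact .inr ⟨z, hzD, h.symm⟩
        · exact .inr ⟨x, hx, h.symm⟩
    · have reach : ∀ v : (D : Set (Fin (n + m + 3))),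
          ((splitGraph n m f).induce (D : Set _)).Reachable v ⟨z, hzD⟩ := by
        rintro ⟨v, hv⟩
        by_cases hvz : v = z
        · subst hvz; exact .refl _
        · rcases step v hvz with h | ⟨x, hx, h, h'⟩
          · exact SimpleGraph.Adj.reachable h
          · have a1 : ((splitGraph n m f).induce (D : Set _)).Adj ⟨v, hv⟩ ⟨x, hx⟩ := h
            have a2 : ((splitGraph n m f).induce (D : Set _)).Adj ⟨x, hx⟩ ⟨z, hzD⟩ := h'
            exact a1.reachable.trans a2.reachable
      exact { preconnected := fun u v => (reach u).trans (reach v).symm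
              nonempty := ⟨⟨z, hzD⟩⟩ }

/-! ### Correspondence of the minimal solutions -/

theorem isHittingSet_iff_code {n : ℕ} {E : Finset (Finset (Fin n))} {f : ℕ → ℕ}
    (hf : IsHypergraphCode E f) (H : Finset (Fin n)) :
    IsHittingSet E H ↔ ∀ j < E.card, ∃ x ∈ H, f (2 + (j * n + x.1)) = 1 := by
  obtain ⟨e, -, -, hfe, -⟩ := hf
  constructor
  · intro h j hj
    obtain ⟨x, hx⟩ := h _ (e ⟨j, hj⟩).2
    rw [Finset.mem_inter] at hx
    exact ⟨x, hx.1, by rw [hfe ⟨j, hj⟩ x, if_pos hx.2]⟩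
  · intro h S hS
    obtain ⟨j, hj⟩ := e.surjective ⟨S, hS⟩
    obtain ⟨x, hx, hfx⟩ := h j j.2
    rw [hfe, hj] at hfx
    exact ⟨x, Finset.mem_inter.2 ⟨hx, by by_contra h'; simp [h'] at hfx⟩⟩

/-- The set `H` together with the vertex `n`. -/
def withApex {n : ℕ} (m : ℕ) (H : Finset (Fin n)) : Finset (Fin (n + m + 3)) :=
  insert ⟨n, by omega⟩ (H.map (Fin.castLEEmb (by omega)))

theorem mem_withApex {n m : ℕ} {H : Finset (Fin n)} {v : Fin (n + m + 3)} :
    v ∈ withApex m H ↔ v.1 = n ∨ ∃ x ∈ H, x.1 = v.1 := by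
  simp [withApex, Fin.ext_iff]

theorem withApex_subset_withApex {n m : ℕ} {H H' : Finset (Fin n)} :
    withApex m H ⊆ withApex m H' ↔ H ⊆ H' := by
  constructor
  · intro h x hx
    have := h (mem_withApex (v := ⟨x.1, by omega⟩) |>.2 (.inr ⟨x, hx, rfl⟩))
    rcases mem_withApex.1 this with h | ⟨y, hy, h⟩
    · exact absurd h x.2.ne
    · rwa [← Fin.ext h]
  · intro h v hv
    rcases mem_withApex.1 hv with h' | ⟨y, hy, h'⟩
    · exact mem_withApex.2 (.inl h')
    · exact mem_withApex.2 (.inr ⟨y, h hy, h'⟩)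

theorem filter_toNats_withApex {n m : ℕ} (H : Finset (Fin n)) :
    (toNats (withApex m H)).filter (· < n) = toNats H := by
  ext k
  simp only [toNats, Finset.mem_filter, Finset.mem_map, Fin.valEmbedding_apply]
  constructor
  · rintro ⟨⟨v, hv, rfl⟩, hk⟩
    rcases mem_withApex.1 hv with h | h
    · omega
    · exact h
  · rintro ⟨x, hx, rfl⟩
    exact ⟨⟨⟨x.1, by omega⟩, mem_withApex.2 (.inr ⟨x, hx, rfl⟩), rfl⟩, x.2⟩

theorem isCDS_withApex_iff {n : ℕ} {E : Finset (Finset (Fin n))} {f : ℕ → ℕ}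
    (hf : IsHypergraphCode E f) (H : Finset (Fin n)) :
    IsCDS (splitGraph n E.card f) (withApex E.card H) ↔ IsHittingSet E H := by
  rw [isHittingSet_iff_code hf, isCDS_splitGraph_iff hf.choose_spec.2.2.2]
  constructor
  · rintro ⟨-, h⟩ j hj
    obtain ⟨v, hv, hvn, hfv⟩ := h j hj
    rcases mem_withApex.1 hv with h' | ⟨x, hx, h'⟩
    · omega
    · exact ⟨x, hx, by rwa [h']⟩
  · intro h
    refine ⟨⟨⟨n, by omega⟩, mem_withApex.2 (.inl rfl), rfl⟩, fun j hj => ?_⟩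
    obtain ⟨x, hx, hfx⟩ := h j hj
    exact ⟨⟨x.1, by omega⟩, mem_withApex.2 (.inr ⟨x, hx, rfl⟩), x.2, hfx⟩

/-- Discarding the edge vertices and pendants from `D` keeps the apex and all hitting elements. -/
theorem exists_withApex_subset {n : ℕ} {E : Finset (Finset (Fin n))} {f : ℕ → ℕ}
    (hf : IsHypergraphCode E f) {D : Finset (Fin (n + E.card + 3))}
    (hD : IsCDS (splitGraph n E.card f) D) :
    ∃ H, IsHittingSet E H ∧ withApex E.card H ⊆ D := by
  obtain ⟨⟨z, hzD, hz⟩, h⟩ := (isCDS_splitGraph_iff hf.choose_spec.2.2.2 D).1 hD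
  refine ⟨Finset.univ.filter fun x => (⟨x.1, by omega⟩ : Fin (n + E.card + 3)) ∈ D, ?_, ?_⟩
  · rw [isHittingSet_iff_code hf]
    intro j hj
    obtain ⟨x, hx, hxn, hfx⟩ := h j hj
    exact ⟨⟨x.1, hxn⟩, by simpa using hx, hfx⟩
  · intro v hv
    rcases mem_withApex.1 hv with h' | ⟨x, hx, h'⟩
    · rwa [Fin.ext (h'.trans hz.symm)]
    · rw [Finset.mem_filter] at hx
      rw [show v = ⟨x.1, by omega⟩ from Fin.ext h'.symm]
      exact hx.2

/-- `withApex` is an order embedding that preserves and reflects solutions, and below every solution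
there is one in its image; hence minimal elements correspond. -/
theorem minimal_isCDS_splitGraph_iff {n : ℕ} {E : Finset (Finset (Fin n))} {f : ℕ → ℕ}
    (hf : IsHypergraphCode E f) (D : Finset (Fin (n + E.card + 3))) :
    Minimal (IsCDS (splitGraph n E.card f)) D ↔
      ∃ H, Minimal (IsHittingSet E) H ∧ D = withApex E.card H := by
  constructor
  · intro hD
    obtain ⟨H, hH, hHD⟩ := exists_withApex_subset hf hD.1
    have hDH : D = withApex E.card H := (hD.eq_of_le ((isCDS_withApex_iff hf H).2 hH) hHD).symm
    refine ⟨H, ⟨hH, fun H' hH' hle => ?_⟩, hDH⟩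
    refine (withApex_subset_withApex (m := E.card)).1 ?_
    rw [← hDH]
    refine hD.2 ((isCDS_withApex_iff hf H').2 hH') ?_
    rw [hDH]
    exact withApex_subset_withApex.2 hle
  · rintro ⟨H, hH, rfl⟩
    refine ⟨(isCDS_withApex_iff hf H).2 hH.1, fun D' hD' hle => ?_⟩
    obtain ⟨H', hH', hHD'⟩ := exists_withApex_subset hf hD'
    exact (withApex_subset_withApex.2
      (hH.2 hH' (withApex_subset_withApex.1 (hHD'.trans hle)))).trans hHD'

/-! ### Computing the split graph -/

/-- Register `1` receives the matrix entry for the row in register `x` and the column in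
register `y`, which is assumed to be smaller. -/
def lowerEntryProg (x y : ℕ) : Prog :=
  -- A comparison `a < b` is the test `b - a ≠ 0` in scratch register `9`; registers `0`, `2`, `4`,
  -- `11` hold `n`, `n + m`, `1`, `n + 1`.
  .seq (.sub 9 11 x) (.ite 9 (.const 1 1) (.seq (.sub 9 0 y) (.ite 9
    (.seq (.sub 9 x 11) (.seq (.mul 9 9 0) (.seq (.add 9 9 y) (.seq (.add 9 9 4)
      (.seq (.add 9 9 4) (.load 1 0 9))))))
    (.seq (.sub 9 y 0) (.ite 9 (.const 1 0)
      (.seq (.sub 9 x 2) (.ite 9 (.const 1 1) (.const 1 0))))))))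

/-- Register `1` receives the matrix entry for the row in register `6` and the column in
register `7`. -/
def entryProg : Prog :=
  .seq (.sub 9 6 7) (.ite 9 (lowerEntryProg 6 7)
    (.seq (.sub 9 7 6) (.ite 9 (lowerEntryProg 7 6) (.const 1 0))))

/-- Compute the next entry of the adjacency matrix, store it, and advance. -/
def cellProg : Prog :=
  .seq entryProg (.seq (.add 9 5 4) (.seq (.store 1 9 1) (.seq (.add 5 5 4) (.seq (.sub 8 10 5)
    (.seq (.add 7 7 4) (.seq (.sub 9 3 7) (.seq (.ite 9 .skip (.seq (.const 7 0) (.add 6 6 4)))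
      -- Clearing the scratch registers makes the loop invariant an equality of states.
      (.seq (.const 9 0) (.const 1 0)))))))))

/-- Set up the registers for computing the adjacency matrix. -/
def setupProg : Prog :=
  -- Register `1` is still `0` here and serves as the constant zero.
  .seq (.const 4 1) (.seq (.load 0 0 1) (.seq (.load 2 0 4) (.seq (.add 11 0 4)
    (.seq (.add 2 0 2) (.seq (.add 3 2 4) (.seq (.add 3 3 4) (.seq (.add 3 3 4)
      (.seq (.mul 10 3 3) (.seq (.store 1 1 3) (.add 8 10 1))))))))))

/-- The registers when `k` entries of the adjacency matrix have been computed. -/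
def matrixRegs (n m k : ℕ) : ℕ → ℕ
  | 0 => n
  | 2 => n + m
  | 3 => n + m + 3
  | 4 => 1
  | 5 => k
  | 6 => k / (n + m + 3)
  | 7 => k % (n + m + 3)
  | 8 => (n + m + 3) * (n + m + 3) - k
  | 10 => (n + m + 3) * (n + m + 3)
  | 11 => n + 1
  | _ => 0

/-- The code of the split graph with only the first `k` entries of the adjacency matrix. -/
def matrixMem (n m : ℕ) (f : ℕ → ℕ) (k : ℕ) : ℕ → ℕ
  | 0 => n + m + 3
  | i + 1 => if i < k then entry n m f (i / (n + m + 3)) (i % (n + m + 3)) else 0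

/-- The memory when `k` entries of the adjacency matrix have been computed. -/
def matrixState (n m : ℕ) (f : ℕ → ℕ) (k : ℕ) : State where
  reg := matrixRegs n m k
  mem := fun a => if a = 0 then f else if a = 1 then matrixMem n m f k else fun _ => 0

theorem State.eq_of_forall {s s' : State} (hr : ∀ x, s.reg x = s'.reg x)
    (hm : ∀ a, s.mem a = s'.mem a) : s = s' := by
  obtain ⟨r, m⟩ := s
  obtain ⟨r', m'⟩ := s'
  obtain rfl : r = r' := funext hr
  obtain rfl : m = m' := funext hm
  rfl

theorem State.setReg_setReg_same (s : State) (x v w : ℕ) :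
    (s.setReg x v).setReg x w = s.setReg x w := by simp [State.setReg]

/-- The final content `w` of the scratch register depends on the branch taken and is left
unspecified. -/
theorem ev_lowerEntryProg {n m : ℕ} {f : ℕ → ℕ} {s : State} {x y : ℕ} (hx : x ≠ 9) (hy : y ≠ 9)
    (h0 : s.reg 0 = n) (h2 : s.reg 2 = n + m) (h4 : s.reg 4 = 1) (h11 : s.reg 11 = n + 1)
    (hf : s.mem 0 = f) :
    ∃ w, ev (lowerEntryProg x y) s =
      (s.setReg 9 w).setReg 1 (lowerEntry n m f (s.reg x) (s.reg y)) := by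
  have r9 : ∀ v, (s.setReg 9 v).reg 9 = v := fun v => by simp [State.setReg]
  have rr : ∀ v z, z ≠ 9 → (s.setReg 9 v).reg z = s.reg z :=
    fun v z hz => by simp [State.setReg, hz]
  have rm : ∀ v, (s.setReg 9 v).mem 0 = f := fun v => hf
  by_cases c1 : s.reg x ≤ n
  · refine ⟨n + 1 - s.reg x, ?_⟩
    have : n + 1 - s.reg x ≠ 0 := by omega
    simp [lowerEntryProg, ev, r9, h11, this, lowerEntry, c1]
  have d1 : n + 1 - s.reg x = 0 := by omega
  by_cases c2 : s.reg y < n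
  · refine ⟨(s.reg x - (n + 1)) * n + s.reg y + 1 + 1, ?_⟩
    have : n - s.reg y ≠ 0 := by omega
    simp [lowerEntryProg, ev, State.setReg_setReg_same, r9, rr, rm, h0, h4, h11, d1, this,
      lowerEntry, c1, c2, hx, hy]
    congr 2
    omega
  have d2 : n - s.reg y = 0 := by omega
  by_cases c3 : n < s.reg y
  · refine ⟨s.reg y - n, ?_⟩
    have : s.reg y - n ≠ 0 := by omega
    simp [lowerEntryProg, ev, State.setReg_setReg_same, r9, rr, h0, h11, d1, d2, this,
      lowerEntry, c1, c2, c3, hy]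
  have d3 : s.reg y - n = 0 := by omega
  refine ⟨s.reg x - (n + m), ?_⟩
  by_cases c4 : n + m < s.reg x
  · have : s.reg x - (n + m) ≠ 0 := by omega
    simp [lowerEntryProg, ev, State.setReg_setReg_same, r9, rr, h0, h2, h11, d1, d2, d3, this,
      lowerEntry, c1, c2, c3, c4, hx, hy]
  · have : s.reg x - (n + m) = 0 := by omega
    simp [lowerEntryProg, ev, State.setReg_setReg_same, r9, rr, h0, h2, h11, d1, d2, d3, this,
      lowerEntry, c1, c2, c3, c4, hx, hy]

theorem ev_entryProg (n m : ℕ) (f : ℕ → ℕ) (k : ℕ) :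
    ∃ w, ev entryProg (matrixState n m f k) = ((matrixState n m f k).setReg 9 w).setReg 1
      (entry n m f (k / (n + m + 3)) (k % (n + m + 3))) := by
  set s := matrixState n m f k with hs
  have h6 : s.reg 6 = k / (n + m + 3) := rfl
  have h7 : s.reg 7 = k % (n + m + 3) := rfl
  have r9 : ∀ v, (s.setReg 9 v).reg 9 = v := fun v => by simp [State.setReg]
  have rr : ∀ v z, z ≠ 9 → (s.setReg 9 v).reg z = s.reg z :=
    fun v z hz => by simp [State.setReg, hz]
  have low : ∀ v x y, x ≠ 9 → y ≠ 9 → ∃ w, ev (lowerEntryProg x y) (s.setReg 9 v) =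
      (s.setReg 9 w).setReg 1 (lowerEntry n m f (s.reg x) (s.reg y)) := by
    intro v x y hx hy
    obtain ⟨w, hw⟩ := ev_lowerEntryProg (n := n) (m := m) (f := f) (s := s.setReg 9 v) hx hy
      (rr v 0 (by decide)) (rr v 2 (by decide)) (rr v 4 (by decide)) (rr v 11 (by decide)) rfl
    rw [State.setReg_setReg_same, rr v x hx, rr v y hy] at hw
    exact ⟨w, hw⟩
  rw [← h6, ← h7]
  by_cases c1 : s.reg 7 < s.reg 6
  · obtain ⟨w, hw⟩ := low (s.reg 6 - s.reg 7) 6 7 (by decide) (by decide)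
    refine ⟨w, ?_⟩
    have : s.reg 6 - s.reg 7 ≠ 0 := by omega
    simp [entryProg, ev, r9, this, hw, entry, c1]
  have d1 : s.reg 6 - s.reg 7 = 0 := by omega
  by_cases c2 : s.reg 6 < s.reg 7
  · obtain ⟨w, hw⟩ := low (s.reg 7 - s.reg 6) 7 6 (by decide) (by decide)
    refine ⟨w, ?_⟩
    have : s.reg 7 - s.reg 6 ≠ 0 := by omega
    simp [entryProg, ev, r9, rr, State.setReg_setReg_same, d1, this, hw, entry, c1, c2]
  · refine ⟨s.reg 7 - s.reg 6, ?_⟩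
    have : s.reg 7 - s.reg 6 = 0 := by omega
    simp [entryProg, ev, r9, rr, State.setReg_setReg_same, d1, this, entry, c1, c2]

theorem matrixMem_succ (n m : ℕ) (f : ℕ → ℕ) (k : ℕ) :
    Function.update (matrixMem n m f k) (k + 1)
      (entry n m f (k / (n + m + 3)) (k % (n + m + 3))) = matrixMem n m f (k + 1) := by
  funext i
  rcases i with _ | i
  · rw [Function.update_of_ne (by omega)]; rfl
  · by_cases h : i = k
    · subst h; simp [matrixMem]
    · rw [Function.update_of_ne (by omega)]
      have : i < k ↔ i < k + 1 := by omega
      simp [matrixMem, this]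

theorem ev_cellProg (n m : ℕ) (f : ℕ → ℕ) (k : ℕ) :
    ev cellProg (matrixState n m f k) = matrixState n m f (k + 1) := by
  obtain ⟨w, hw⟩ := ev_entryProg n m f k
  have hmem := matrixMem_succ n m f k
  have hN : 0 < n + m + 3 := by omega
  have hlt := Nat.mod_lt k hN
  have hdm := Nat.mod_add_div k (n + m + 3)
  by_cases c : k % (n + m + 3) + 1 = n + m + 3
  -- End of a row: the column returns to `0` and the row advances.
  · have hk : k + 1 = 0 + (n + m + 3) * (k / (n + m + 3) + 1) := by rw [Nat.mul_succ]; omega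
    obtain ⟨hq, hr⟩ := (Nat.div_mod_unique (a := k + 1) hN).2 ⟨hk.symm, hN⟩
    have hc : n + m + 3 - (k % (n + m + 3) + 1) = 0 := by omega
    refine State.eq_of_forall (fun x => ?_) (fun a => ?_)
    · simp only [cellProg, ev, hw]
      rcases x with _ | _ | _ | _ | _ | _ | _ | _ | _ | _ | _ | _ | x <;>
        simp [State.setReg, State.setMem, matrixState, matrixRegs, hq, hr, hc]
    · simp only [cellProg, ev, hw]
      rcases a with _ | _ | a <;>
        simp [State.setReg, State.setMem, matrixState, matrixRegs, hc, hmem]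
  · have hk : k + 1 = (k % (n + m + 3) + 1) + (n + m + 3) * (k / (n + m + 3)) := by omega
    obtain ⟨hq, hr⟩ := (Nat.div_mod_unique (a := k + 1) hN).2 ⟨hk.symm, by omega⟩
    have hc : n + m + 2 - k % (n + m + 3) ≠ 0 := by omega
    refine State.eq_of_forall (fun x => ?_) (fun a => ?_)
    · simp only [cellProg, ev, hw]
      rcases x with _ | _ | _ | _ | _ | _ | _ | _ | _ | _ | _ | _ | x <;>
        simp [State.setReg, State.setMem, matrixState, matrixRegs, hq, hr, hc]
    · simp only [cellProg, ev, hw]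
      rcases a with _ | _ | a <;>
        simp [State.setReg, State.setMem, matrixState, matrixRegs, hc, hmem]

theorem ev_setupProg {n m : ℕ} {f : ℕ → ℕ} (h0 : f 0 = n) (h1 : f 1 = m) :
    ev setupProg (State.init f) = matrixState n m f 0 := by
  refine State.eq_of_forall (fun x => ?_) (fun a => ?_)
  · rcases x with _ | _ | _ | _ | _ | _ | _ | _ | _ | _ | _ | _ | x <;>
      simp [setupProg, ev, State.init, State.setReg, State.setMem, matrixState, matrixRegs, h0, h1]
  · rcases a with _ | _ | a
    · simp [setupProg, ev, State.init, State.setReg, State.setMem, matrixState]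
    · funext i
      rcases i with _ | i <;>
        simp [setupProg, ev, State.init, State.setReg, State.setMem, matrixState, matrixMem, h0, h1]
    · simp [setupProg, ev, State.init, State.setReg, State.setMem, matrixState]

/-- Compute the code of the split graph in array `1`. -/
def splitGraphProg : Prog := .seq setupProg (.loop 8 cellProg)

/-! ### Running time of the construction -/

theorem lowerEntry_le {n m : ℕ} {f : ℕ → ℕ} {M : ℕ} (hM : 1 ≤ M) (hf : ∀ k, 2 ≤ k → f k ≤ M)
    (u v : ℕ) :
    lowerEntry n m f u v ≤ M := by
  unfold lowerEntry
  split_ifs <;> first | exact hf _ (by omega) | omega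

theorem entry_le {n m : ℕ} {f : ℕ → ℕ} {M : ℕ} (hM : 1 ≤ M) (hf : ∀ k, 2 ≤ k → f k ≤ M)
    (u v : ℕ) :
    entry n m f u v ≤ M := by
  unfold entry
  split_ifs
  · exact lowerEntry_le hM hf _ _
  · exact lowerEntry_le hM hf _ _
  · omega

theorem bounded_init {f : ℕ → ℕ} {M : ℕ} (hf : ∀ k, f k ≤ M) : Bounded (State.init f) M := by
  refine ⟨fun x => Nat.zero_le _, fun a i => ?_⟩
  by_cases ha : a = 0 <;> simp [State.init, ha, hf]

/-- A bound uniform in `k` is essential: iterating the polynomial of a single pass would not give a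
polynomial. -/
theorem bounded_matrixState {n m : ℕ} {f : ℕ → ℕ} (hf : ∀ k, f k ≤ n + m + 1) {k : ℕ}
    (hk : k ≤ (n + m + 3) * (n + m + 3)) :
    Bounded (matrixState n m f k) ((n + m + 3) * (n + m + 3)) := by
  have hNN : n + m + 3 ≤ (n + m + 3) * (n + m + 3) := Nat.le_mul_self _
  have h1 : k / (n + m + 3) ≤ k := Nat.div_le_self _ _
  have h2 : k % (n + m + 3) ≤ k := Nat.mod_le _ _
  have hf' : ∀ k, f k ≤ (n + m + 3) * (n + m + 3) := fun k => (hf k).trans (by omega)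
  refine ⟨fun x => ?_, fun a i => ?_⟩
  · change matrixRegs n m k x ≤ _
    unfold matrixRegs
    split <;> omega
  · rcases a with _ | _ | a
    · simpa [matrixState] using hf' i
    · rcases i with _ | i
      · exact hNN
      · change (if i < k then entry n m f (i / (n + m + 3)) (i % (n + m + 3)) else 0) ≤ _
        split_ifs
        · exact entry_le (by omega) (fun k _ => hf' k) _ _
        · omega
    · simp [matrixState]

theorem exists_polynomial_splitGraphProg : ∃ q : Polynomial ℕ, ∀ (n m : ℕ) (f : ℕ → ℕ),
    f 0 = n → f 1 = m → (∀ k, f k ≤ n + m + 1) →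
    Runs splitGraphProg (State.init f) (q.eval (n + m))
      (matrixState n m f ((n + m + 3) * (n + m + 3))) := by
  obtain ⟨q₁, h₁⟩ := IsStraight.exists_polynomial (c := setupProg) (by simp [setupProg, IsStraight])
  obtain ⟨q₂, h₂⟩ := IsStraight.exists_polynomial (c := cellProg)
    (by simp [cellProg, entryProg, lowerEntryProg, IsStraight])
  let N : Polynomial ℕ := (.X + 3) * (.X + 3)
  refine ⟨q₁.comp (.X + 1) + (N * (q₂.comp N + (N + 1)) + (N + 1)), fun n m f h0 hm hf => ?_⟩
  have hN : N.eval (n + m) = (n + m + 3) * (n + m + 3) := by simp [N]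
  simp only [Polynomial.eval_add, Polynomial.eval_mul, Polynomial.eval_comp, hN,
    Polynomial.eval_X, Polynomial.eval_one]
  have e₁ := (h₁ _ _ (bounded_init hf)).1
  rw [ev_setupProg h0 hm] at e₁
  have hr : ∀ k, (matrixState n m f k).reg 8 = (n + m + 3) * (n + m + 3) - k := fun _ => rfl
  refine e₁.seq (Runs.loop (S := matrixState n m f) (fun k hk => ?_) ?_ (fun k hk => ?_)
    fun k hk => ?_)
  · rw [hr]; omega
  · rw [hr]; omega
  · have := logCost_le ((matrixState n m f k).reg 8)
    rw [hr] at this ⊢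
    omega
  · rw [← ev_cellProg]
    exact (h₂ _ _ (bounded_matrixState hf hk.le)).1

theorem IsHypergraphCode.le_one {n : ℕ} {E : Finset (Finset (Fin n))} {f : ℕ → ℕ}
    (hf : IsHypergraphCode E f) (k : ℕ) (hk : 2 ≤ k) : f k ≤ 1 := by
  obtain ⟨e, -, -, hfe, hz⟩ := hf
  obtain ⟨k, rfl⟩ := Nat.exists_eq_add_of_le hk
  by_cases hk : k < E.card * n
  · have hn : 0 < n := Nat.pos_of_ne_zero fun h => by simp [h] at hk
    have := hfe ⟨k / n, Nat.div_lt_of_lt_mul (by rwa [mul_comm])⟩ ⟨k % n, Nat.mod_lt _ hn⟩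
    rw [Nat.div_add_mod'] at this
    rw [this]
    split_ifs <;> omega
  · rw [hz _ (by omega)]; omega

theorem IsHypergraphCode.le {n : ℕ} {E : Finset (Finset (Fin n))} {f : ℕ → ℕ}
    (hf : IsHypergraphCode E f) (k : ℕ) : f k ≤ n + E.card + 1 := by
  have h := hf.le_one k
  obtain ⟨e, h0, h1, -, -⟩ := hf
  rcases k with _ | _ | k
  · omega
  · rw [zero_add, h1]; omega
  · have := h (by omega); omega

/-! ### Input of the given algorithm -/

theorem isGraphCode_splitGraph {n m : ℕ} {f : ℕ → ℕ} (hf : ∀ k, 2 ≤ k → f k ≤ 1) :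
    IsGraphCode (splitGraph n m f) (matrixMem n m f ((n + m + 3) * (n + m + 3))) := by
  refine ⟨rfl, fun u v => ?_, fun k hk => ?_⟩
  · have hN : 0 < n + m + 3 := by omega
    obtain ⟨hq, hr⟩ := (Nat.div_mod_unique (a := u.1 * (n + m + 3) + v.1) (d := u.1) (c := v.1)
      hN).2 ⟨by rw [mul_comm, add_comm], v.2⟩
    have hlt : u.1 * (n + m + 3) + v.1 < (n + m + 3) * (n + m + 3) := by
      have h1 : (u.1 + 1) * (n + m + 3) ≤ _ := Nat.mul_le_mul_right (n + m + 3) u.2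
      have h2 := v.2
      rw [Nat.succ_mul u.1] at h1
      omega
    rw [add_comm 1]
    simp only [matrixMem, hq, hr, if_pos hlt]
    have := entry_le (n := n) (m := m) le_rfl hf u.1 v.1
    split_ifs with h
    · exact h
    · have h' : entry n m f u v ≠ 1 := h
      omega
  · obtain ⟨k, rfl⟩ := Nat.exists_eq_add_of_le' (show 1 ≤ k by omega)
    simp only [matrixMem]
    rw [if_neg (by omega)]

/-- The construction uses only registers below `12` and arrays `0` and `1`, so the shifted copy
finds its input in array `1` and otherwise zeros. -/
theorem shiftRel_matrixState (n m : ℕ) (f : ℕ → ℕ) (k : ℕ) :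
    ShiftRel n (State.init (matrixMem n m f k)) (matrixState n m f k) :=
  ⟨fun _ => rfl, fun a => by rcases a with _ | a <;> simp [State.init, matrixState], rfl⟩

theorem toFinset_filter_lt (n : ℕ) (l : List ℕ) :
    (l.filter (· < n)).toFinset = l.toFinset.filter (· < n) := by
  ext; simp

/-! ### The reduction -/

theorem hasPolyDelayAlgorithm_minimalHittingSets
    (h : minimalCDSInSplitGraphs.HasPolyDelayAlgorithm) :
    minimalHittingSets.HasPolyDelayAlgorithm := by
  obtain ⟨c, p, h⟩ := h
  obtain ⟨q, hq⟩ := exists_polynomial_splitGraphProg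
  -- Construction time, plus the slowdown of filtering times the old delay on a graph with `n + m +
  -- 3` vertices.
  refine ⟨.seq splitGraphProg (shiftFilter c), q + (2 * .X + 5) * p.comp (.X + 3), ?_⟩
  rintro ⟨n, E⟩ f (hf : IsHypergraphCode E f)
  set N := n + E.card + 3 with hN
  obtain ⟨tr, s₁, hexec, hnodup, hsol, hdelay⟩ := h ⟨N, splitGraph n E.card f,
    isSplit_splitGraph n E.card f⟩ _ (isGraphCode_splitGraph hf.le_one)
  obtain ⟨tr₀, t₀, hexec₀, hsilent, ht₀⟩ := hq n E.card f hf.choose_spec.1 hf.choose_spec.2.1 hf.le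
  obtain ⟨tr', s', hexec', -, hrel⟩ := exec_shiftFilter (A := q.eval (n + E.card))
    (B := 2 * (n + E.card) + 5) (by omega) hexec (shiftRel_matrixState n E.card f _)
  have hbound := hrel _ _ (traceBound_nil _ _ _)
  rw [List.append_nil, List.append_nil] at hbound
  obtain ⟨hout, hdel⟩ := hbound
  have hsets : (outputs [] (tr₀ ++ tr')).map List.toFinset =
      ((outputs [] tr).map List.toFinset).map (Finset.filter (· < n)) := by
    have := hout []
    rw [List.filter_nil] at this
    rw [hsilent.1, this, List.map_map, List.map_map]
    exact List.map_congr_left fun l _ => toFinset_filter_lt n l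
  have hsol' : ∀ D, D ∈ (outputs [] tr).map List.toFinset ↔
      ∃ H, Minimal (IsHittingSet E) H ∧ D = toNats (withApex E.card H) := by
    intro D
    rw [hsol]
    constructor
    · rintro ⟨D', hD', rfl⟩
      obtain ⟨H, hH, rfl⟩ := (minimal_isCDS_splitGraph_iff hf D').1 hD'
      exact ⟨H, hH, rfl⟩
    · rintro ⟨H, hH, rfl⟩
      exact ⟨_, (minimal_isCDS_splitGraph_iff hf _).2 ⟨H, hH, rfl⟩, rfl⟩
  refine ⟨tr₀ ++ tr', s', .seq hexec₀ hexec', ?_, fun D => ?_, fun t ht => ?_⟩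
  · rw [hsets]
    -- Filtering is not injective on all sets, but it is on the solutions, which all have the form
    -- `H ∪ {n}`.
    refine hnodup.map_on fun D hD D' hD' hDD' => ?_
    obtain ⟨H, -, rfl⟩ := (hsol' D).1 hD
    obtain ⟨H', -, rfl⟩ := (hsol' D').1 hD'
    rw [filter_toNats_withApex, filter_toNats_withApex] at hDD'
    rw [Finset.map_injective _ hDD']
  · rw [hsets, List.mem_map]
    constructor
    · rintro ⟨D', hD', rfl⟩
      obtain ⟨H, hH, rfl⟩ := (hsol' D').1 hD'
      exact ⟨H, hH, filter_toNats_withApex H⟩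
    · rintro ⟨H, hH, rfl⟩
      exact ⟨_, (hsol' _).2 ⟨H, hH, rfl⟩, filter_toNats_withApex H⟩
  · rw [hsilent.2, zero_add] at ht
    -- The clock of the copy starts at the construction time `t₀`, which is at most `A`.
    obtain ⟨a, ha, hat⟩ := exists_mem_of_forall₂ (hdel 0 t₀ (by omega)) ht
    refine hat.trans ?_
    have := Nat.mul_le_mul_left (2 * (n + E.card) + 5) (hdelay a ha)
    simpa [minimalHittingSets, minimalCDSInSplitGraphs, hN] using this

end PolyDelay

theorem mainTheorem7
    (h : PolyDelay.minimalCDSInSplitGraphs.HasPolyDelayAlgorithm) :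
    PolyDelay.minimalHittingSets.HasPolyDelayAlgorithm :=
  PolyDelay.hasPolyDelayAlgorithm_minimalHittingSets h
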